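/- For a polynomial $P \in \mathbb{C}[x,y]$ with $P \neq 0$, let $$\mathrm{m}(P) = \frac{1}{(2\pi i)^2}\int_{|x|=|y|=1} \log|P(x,y)|\,\frac{dx}{x}\frac{dy}{y} = \frac{1}{(2\pi)^2}\int_0^{2\pi}\!\!\int_0^{2\pi} \log\bigl|P(e^{i\theta_1},e^{i\theta_2})\bigr|\,d\theta_1\,d\theta_2$$ denote its (logarithmic) Mahler measure. For real parameters $\alpha$, $\beta$ put $$Q_\alpha(x,y)=(x^2+x+1)y^2+\alpha x(x+1)y+x(x^2+x+1),$$ $$R_\beta(x,y)=(x^2+x+1)y^2+\bigl(x^4+\beta x^3+(2\beta-4)x^2+\beta x+1\bigr)y+x^2(x^2+x+1).$$ Then for every real $\alpha\geq 4$ the integrals defining $\mathrm{m}(Q_\alpha)$ and $\mathrm{m}(R_{\alpha+2})$ converge absolutely, and $$\mathrm{m}(Q_\alpha)=\mathrm{m}(R_{\alpha+2}).$$ -/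

import Mathlib

noncomputable section

/-- The (logarithmic) Mahler measure of a polynomial `P ∈ ℂ[x₁, …, xₙ]`: the mean value of
`log |P|` over the unit torus `|x₁| = ⋯ = |xₙ| = 1`, parametrized by `x_j = exp (i θ_j)`,
`0 ≤ θ_j ≤ 2π`. -/
def mahlerMeasureLog {n : ℕ} (P : MvPolynomial (Fin n) ℂ) : ℝ :=
  (2 * Real.pi) ^ (-(n : ℤ)) *
    ∫ θ in Set.Icc (0 : Fin n → ℝ) (fun _ => 2 * Real.pi),
      Real.log ‖MvPolynomial.eval (torusMap 0 1 θ) P‖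

/-- The integral defining the Mahler measure is absolutely convergent, i.e. `log |P|` is
integrable over the unit torus. -/
def MahlerIntegrable {n : ℕ} (P : MvPolynomial (Fin n) ℂ) : Prop :=
  TorusIntegrable (fun z => Real.log ‖MvPolynomial.eval z P‖) 0 1

/-- The Mahler measure is
`(2πi)⁻ⁿ ∮_{𝕋ⁿ} log |P(x₁, …, xₙ)| (dx₁ / x₁) ⋯ (dxₙ / xₙ)`. -/
theorem mahlerMeasureLog_eq_torusIntegral {n : ℕ} (P : MvPolynomial (Fin n) ℂ) :
    (mahlerMeasureLog P : ℂ) =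
      (2 * Real.pi * Complex.I) ^ (-(n : ℤ)) *
        torusIntegral (fun z => (Real.log ‖MvPolynomial.eval z P‖ : ℂ) * ∏ i, (z i)⁻¹) 0 1 := by
  have key : ∀ θ : Fin n → ℝ,
      (∏ i, ((1 : Fin n → ℝ) i : ℂ) * Complex.exp (θ i * Complex.I) * Complex.I : ℂ) •
        ((Real.log ‖MvPolynomial.eval (torusMap 0 1 θ) P‖ : ℂ) * ∏ i, (torusMap 0 1 θ i)⁻¹)
      = Complex.I ^ n * ((Real.log ‖MvPolynomial.eval (torusMap 0 1 θ) P‖ : ℝ) : ℂ) := by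
    intro θ
    have h : (∏ i, Complex.exp (θ i * Complex.I)) ≠ 0 :=
      Finset.prod_ne_zero_iff.2 fun i _ => Complex.exp_ne_zero _
    simp only [torusMap, Pi.one_apply, Pi.zero_apply, Complex.ofReal_one, one_mul, zero_add,
      Finset.prod_mul_distrib, Finset.prod_const, Finset.card_univ, Fintype.card_fin,
      Finset.prod_inv_distrib, smul_eq_mul]
    generalize (∏ i, Complex.exp (θ i * Complex.I)) = p at h
    field_simp
  have hI : (Complex.I ^ n : ℂ) ≠ 0 := pow_ne_zero _ Complex.I_ne_zero
  have hpi : (Real.pi : ℂ) ≠ 0 := Complex.ofReal_ne_zero.2 Real.pi_ne_zero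
  unfold torusIntegral mahlerMeasureLog
  simp_rw [key]
  rw [MeasureTheory.integral_const_mul, integral_complex_ofReal]
  push_cast
  simp only [zpow_neg, zpow_natCast]
  field_simp
  ring

/-- `Q_α(x, y) = (x² + x + 1) y² + α x (x + 1) y + x (x² + x + 1)`. -/
def polyQ (α : ℝ) : MvPolynomial (Fin 2) ℂ :=
  let x : MvPolynomial (Fin 2) ℂ := MvPolynomial.X 0
  let y : MvPolynomial (Fin 2) ℂ := MvPolynomial.X 1
  let a : MvPolynomial (Fin 2) ℂ := MvPolynomial.C (α : ℂ)
  (x ^ 2 + x + 1) * y ^ 2 + a * x * (x + 1) * y + x * (x ^ 2 + x + 1)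

/-- `R_β(x, y) =
(x² + x + 1) y² + (x⁴ + β x³ + (2β - 4) x² + β x + 1) y + x² (x² + x + 1)`. -/
def polyR (β : ℝ) : MvPolynomial (Fin 2) ℂ :=
  let x : MvPolynomial (Fin 2) ℂ := MvPolynomial.X 0
  let y : MvPolynomial (Fin 2) ℂ := MvPolynomial.X 1
  let b : MvPolynomial (Fin 2) ℂ := MvPolynomial.C (β : ℂ)
  (x ^ 2 + x + 1) * y ^ 2 + (x ^ 4 + b * x ^ 3 + (2 * b - 4) * x ^ 2 + b * x + 1) * y
    + x ^ 2 * (x ^ 2 + x + 1)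

end

open Real MeasureTheory Set Filter Topology

/-! Put z = |1 + x|² = 2 + 2 cos θ for x = e^{iθ}. Up to a factor of modulus one, both polynomials
on the torus are 2A cos(φ - s) + B with A = z - 1, where B = ±α√z for Q_α and B = z² + (α - 2)z - 2
for R_{α+2}. Jensen's formula in y gives the mean `logMeanCos A B`, so both Mahler measures are
means over θ of functions of z (`mahler_polyQ`, `mahler_polyR`).

The B-derivative of `logMeanCos A B` is 1/√(B² - 4A²) for B > 2|A|, and 0 for |B| < 2|A|.
Differentiating in α and replacing θ by z gives two elliptic integrals over (0, 4), with radicands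
(4 - z)(α²z - 4(z - 1)²) and (4 - z)(z + α - 4)(z² + αz - 4). A Möbius map matches their branch
points, so the integrals agree (`lintegral_elliptic_eq`), and m(Q_α) - m(R_{α+2}) is constant on α ≥
4 (`lintegral_meanQ_sub_eq_lintegral_meanR_sub`).

The constant is found at infinity: after subtracting log α, the two means tend to (log z)/2 and log
z, and both limits integrate to 0 because m(1 + x) = 0 (`integral_meanQ_eq_integral_meanR`). -/

noncomputable section

/-! ### Jensen's formula for reciprocal quadratics -/

/-- The mean value of `log |2 A cos φ + B|` over a period. -/
def logMeanCos (A B : ℝ) : ℝ :=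
  log ((max |B| (2 * |A|) + √(max |B| (2 * |A|) ^ 2 - 4 * A ^ 2)) / 2)

/-- The roots of Ar² + Br + A are r and 1/r; the one chosen lies on or outside the unit circle. They
are real if |B| ≥ 2|A| and on the circle otherwise. The maximum covers both cases, since it makes
the square root vanish in the second. -/
lemma exists_root_reciprocal_quadratic {A : ℝ} (hA : A ≠ 0) (B : ℝ) :
    ∃ r : ℂ, r ≠ 0 ∧ (A : ℂ) * (r + r⁻¹) = -B ∧
      ‖r‖ = (max |B| (2 * |A|) + √(max |B| (2 * |A|) ^ 2 - 4 * A ^ 2)) / (2 * |A|) := by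
  have hA' : (A : ℂ) ≠ 0 := by exact_mod_cast hA
  have hAp : 0 < |A| := abs_pos.2 hA
  rcases le_or_gt (2 * |A|) |B| with h | h
  · rw [max_eq_left h]
    have hnn : 0 ≤ |B| ^ 2 - 4 * A ^ 2 := by
      rw [← sq_abs A]; nlinarith
    set S := √(|B| ^ 2 - 4 * A ^ 2) with hS
    have hS2 : S ^ 2 = B ^ 2 - 4 * A ^ 2 := by rw [hS, Real.sq_sqrt hnn, sq_abs]
    have hS0 : 0 ≤ S := Real.sqrt_nonneg _
    have hpos : 0 < |B| + S := by linarith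
    -- T is ±S with the sign of B, which selects the root of larger modulus.
    obtain ⟨T, hT, hT2⟩ : ∃ T : ℝ, |B + T| = |B| + S ∧ T ^ 2 = S ^ 2 := by
      rcases le_total 0 B with hB | hB
      · exact ⟨S, by rw [abs_of_nonneg hB, abs_of_nonneg (by linarith)], rfl⟩
      · exact ⟨-S, by rw [abs_of_nonpos hB, abs_of_nonpos (by linarith)]; ring, by ring⟩
    have hBT : B + T ≠ 0 := by
      intro h0; rw [h0, abs_zero] at hT; linarith
    have hreal : A * (-(B + T) / (2 * A) + (-(B + T) / (2 * A))⁻¹) = -B := by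
      field_simp
      linear_combination -hT2 - hS2
    refine ⟨((-(B + T) / (2 * A) : ℝ) : ℂ), ?_, ?_, ?_⟩
    · exact_mod_cast div_ne_zero (neg_ne_zero.2 hBT) (mul_ne_zero two_ne_zero hA)
    · exact_mod_cast hreal
    · rw [Complex.norm_real, norm_eq_abs, abs_div, abs_neg, hT, abs_mul, abs_two]
  · rw [max_eq_right h.le]
    have h0 : (2 * |A|) ^ 2 - 4 * A ^ 2 = 0 := by rw [mul_pow, sq_abs]; ring
    have hlt : B ^ 2 < 4 * A ^ 2 := by
      rw [← sq_abs B, ← sq_abs A]; nlinarith [abs_nonneg B]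
    have hc2 : (B / (2 * A)) ^ 2 ≤ 1 := by
      rw [div_pow, div_le_one (by positivity)]; linarith
    obtain ⟨hc1, hc3⟩ := abs_le.1 ((sq_le_one_iff_abs_le_one _).1 hc2)
    set c := Complex.exp (arccos (-(B / (2 * A))) * Complex.I) with hc
    refine ⟨c, Complex.exp_ne_zero _, ?_, ?_⟩
    · have hcos : c + c⁻¹ = 2 * (Real.cos (arccos (-(B / (2 * A)))) : ℂ) := by
        rw [hc, ← Complex.exp_neg, Complex.ofReal_cos, Complex.cos]
        ring_nf
      rw [hcos, Real.cos_arccos (by linarith) (by linarith)]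
      push_cast
      field_simp
    · rw [h0, Real.sqrt_zero, hc, Complex.norm_exp_ofReal_mul_I]
      field_simp
      ring

lemma norm_eval_reciprocal_quadratic (A B φ : ℝ) :
    ‖(Polynomial.C (A : ℂ) * Polynomial.X ^ 2 + Polynomial.C (B : ℂ) * Polynomial.X
      + Polynomial.C (A : ℂ)).eval (circleMap 0 1 φ)‖ = |2 * A * cos φ + B| := by
  have : (Polynomial.C (A : ℂ) * Polynomial.X ^ 2 + Polynomial.C (B : ℂ) * Polynomial.X
      + Polynomial.C (A : ℂ)).eval (circleMap 0 1 φ) =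
      Complex.exp (φ * Complex.I) * ((2 * A * cos φ + B : ℝ) : ℂ) := by
    simp only [circleMap, Polynomial.eval_add, Polynomial.eval_mul, Polynomial.eval_pow,
      Polynomial.eval_C, Polynomial.eval_X, Complex.ofReal_one, one_mul, zero_add]
    push_cast
    rw [Complex.cos, neg_mul, Complex.exp_neg]
    field_simp [Complex.exp_ne_zero]
    ring
  rw [this, norm_mul, Complex.norm_exp_ofReal_mul_I, one_mul, Complex.norm_real, norm_eq_abs]

lemma intervalIntegrable_log_abs_two_mul_cos_add (A B a b : ℝ) :
    IntervalIntegrable (fun φ => log |2 * A * cos φ + B|) volume a b := by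
  have hm : MeromorphicOn (fun φ : ℝ => 2 * A * cos φ + B) (uIcc a b) := fun x _ => by
    have : AnalyticAt ℝ (fun φ : ℝ => 2 * A * cos φ + B) x := by fun_prop
    exact this.meromorphicAt
  simpa [norm_eq_abs] using hm.intervalIntegrable_log_norm

/-- With roots r and 1/r, |r| ≥ 1, the measure is log |A| + log |r|. For A = B = 0 both sides are 0
through the convention log 0 = 0. -/
lemma logMahlerMeasure_reciprocal_quadratic (A B : ℝ) :
    (Polynomial.C (A : ℂ) * Polynomial.X ^ 2 + Polynomial.C (B : ℂ) * Polynomial.X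
      + Polynomial.C (A : ℂ)).logMahlerMeasure = logMeanCos A B := by
  rcases eq_or_ne A 0 with rfl | hA
  · rcases eq_or_ne B 0 with rfl | hB
    · simp [logMeanCos]
    · have hB' : (B : ℂ) ≠ 0 := by exact_mod_cast hB
      simp only [Complex.ofReal_zero, map_zero, zero_mul, zero_add, add_zero]
      rw [Polynomial.logMahlerMeasure_C_mul hB' Polynomial.X_ne_zero]
      simp [logMeanCos, Real.sqrt_sq_eq_abs]
  · obtain ⟨r, hr0, hr, hrn⟩ := exists_root_reciprocal_quadratic hA B
    have hA' : (A : ℂ) ≠ 0 := by exact_mod_cast hA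
    have hfac : Polynomial.C (A : ℂ) * Polynomial.X ^ 2 + Polynomial.C (B : ℂ) * Polynomial.X
        + Polynomial.C (A : ℂ) = Polynomial.C (A : ℂ) *
          ((Polynomial.X - Polynomial.C r) * (Polynomial.X - Polynomial.C r⁻¹)) := by
      have h1 : (B : ℂ) = -(A * (r + r⁻¹)) := by rw [hr, neg_neg]
      have h2 : Polynomial.C r * Polynomial.C r⁻¹ = 1 := by
        rw [← Polynomial.C_mul, mul_inv_cancel₀ hr0, Polynomial.C_1]
      rw [h1]
      simp only [map_neg, map_mul, map_add]
      linear_combination (-Polynomial.C (A : ℂ)) * h2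
    have hne : (Polynomial.X - Polynomial.C r) * (Polynomial.X - Polynomial.C r⁻¹) ≠ 0 :=
      mul_ne_zero (Polynomial.X_sub_C_ne_zero _) (Polynomial.X_sub_C_ne_zero _)
    have hAp : 0 < |A| := abs_pos.2 hA
    have h1r : 1 ≤ ‖r‖ := by
      rw [hrn, one_le_div (by positivity)]
      have := le_max_right |B| (2 * |A|)
      have := Real.sqrt_nonneg (max |B| (2 * |A|) ^ 2 - 4 * A ^ 2)
      linarith
    rw [hfac, Polynomial.logMahlerMeasure_C_mul hA' hne,
      Polynomial.logMahlerMeasure_mul_eq_add_logMahlerMeasure hne,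
      Polynomial.logMahlerMeasure_X_sub_C, Polynomial.logMahlerMeasure_X_sub_C,
      posLog_eq_log (by simpa using h1r), (posLog_eq_zero_iff ‖r⁻¹‖).2
        (by rw [norm_inv, abs_inv, abs_norm]; exact inv_le_one_of_one_le₀ h1r),
      add_zero, Complex.norm_real, norm_eq_abs, ← Real.log_mul hAp.ne' (by positivity), hrn,
      logMeanCos]
    congr 1
    field_simp

theorem integral_log_abs_two_mul_cos_add (A B : ℝ) :
    ∫ φ in 0..2 * π, log |2 * A * cos φ + B| = 2 * π * logMeanCos A B := by
  have h := logMahlerMeasure_reciprocal_quadratic A B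
  rw [Polynomial.logMahlerMeasure_def, circleAverage_def] at h
  simp only [norm_eval_reciprocal_quadratic] at h
  rw [← h, smul_eq_mul]
  field_simp

lemma integral_log_abs_two_mul_cos_sub_add (A B s : ℝ) :
    ∫ φ in 0..2 * π, log |2 * A * cos (φ - s) + B| = 2 * π * logMeanCos A B := by
  rw [intervalIntegral.integral_comp_sub_right (fun φ => log |2 * A * cos φ + B|),
    ← integral_log_abs_two_mul_cos_add]
  have hp : Function.Periodic (fun φ => log |2 * A * cos φ + B|) (2 * π) := fun φ => by
    simp only [cos_add_two_pi]
  have := hp.intervalIntegral_add_eq (0 - s) 0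
  rw [zero_add] at this
  rw [← this]
  congr 1
  ring

/-! ### Bounds for `logMeanCos` and its derivative in B -/

lemma continuous_arg_logMeanCos : Continuous fun p : ℝ × ℝ =>
    (max |p.2| (2 * |p.1|) + √(max |p.2| (2 * |p.1|) ^ 2 - 4 * p.1 ^ 2)) / 2 := by
  fun_prop

lemma measurable_logMeanCos : Measurable fun p : ℝ × ℝ => logMeanCos p.1 p.2 :=
  Real.measurable_log.comp continuous_arg_logMeanCos.measurable

lemma log_half_le_logMeanCos {A B d : ℝ} (hd : 0 < d) (h : d ≤ max |B| (2 * |A|)) :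
    log (d / 2) ≤ logMeanCos A B := by
  apply Real.log_le_log (by positivity)
  have := Real.sqrt_nonneg (max |B| (2 * |A|) ^ 2 - 4 * A ^ 2)
  linarith

lemma logMeanCos_le_log {A B d : ℝ} (hpos : 0 < max |B| (2 * |A|)) (h : max |B| (2 * |A|) ≤ d) :
    logMeanCos A B ≤ log d := by
  have h0 := Real.sqrt_nonneg (max |B| (2 * |A|) ^ 2 - 4 * A ^ 2)
  apply Real.log_le_log (by positivity)
  have : √(max |B| (2 * |A|) ^ 2 - 4 * A ^ 2) ≤ max |B| (2 * |A|) :=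
    Real.sqrt_le_iff.2 ⟨hpos.le, by nlinarith [sq_nonneg A]⟩
  linarith

lemma lintegral_one_div_sqrt_sq_sub {A d₁ d₂ : ℝ} (hpos : 0 < d₁) (h : 2 * |A| ≤ d₁)
    (h12 : d₁ ≤ d₂) :
    ∫⁻ x in Ioc d₁ d₂, ENNReal.ofReal (1 / √(x ^ 2 - 4 * A ^ 2)) =
      ENNReal.ofReal (log ((d₂ + √(d₂ ^ 2 - 4 * A ^ 2)) / 2) -
        log ((d₁ + √(d₁ ^ 2 - 4 * A ^ 2)) / 2)) := by
  have hgt : ∀ x, d₁ < x → 0 < x ^ 2 - 4 * A ^ 2 := fun x hx => by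
    rw [← sq_abs A]; nlinarith [abs_nonneg A]
  have hc : ContinuousOn (fun x => log ((x + √(x ^ 2 - 4 * A ^ 2)) / 2)) (Icc d₁ d₂) := by
    apply ContinuousOn.log (by fun_prop)
    intro x hx
    have := Real.sqrt_nonneg (x ^ 2 - 4 * A ^ 2)
    have := hx.1
    exact ne_of_gt (by linarith)
  have hd : ∀ x ∈ Ioo d₁ d₂, HasDerivAt (fun x => log ((x + √(x ^ 2 - 4 * A ^ 2)) / 2))
      (1 / √(x ^ 2 - 4 * A ^ 2)) x := fun x hx => by
    have h0 := hgt x hx.1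
    have hs := Real.sqrt_pos.2 h0
    have hx0 := hpos.trans hx.1
    have h1 : HasDerivAt (fun x : ℝ => x ^ 2 - 4 * A ^ 2) (2 * x) x := by
      simpa using (hasDerivAt_pow 2 x).sub_const (4 * A ^ 2)
    have h2 : HasDerivAt (fun x : ℝ => (x + √(x ^ 2 - 4 * A ^ 2)) / 2)
        ((1 + 2 * x / (2 * √(x ^ 2 - 4 * A ^ 2))) / 2) x :=
      ((hasDerivAt_id' x).add (h1.sqrt h0.ne')).div_const 2
    convert h2.log (by positivity) using 1
    field_simp
    ring
  have hn : ∀ x ∈ Ioo d₁ d₂, 0 ≤ 1 / √(x ^ 2 - 4 * A ^ 2) := fun x _ => by positivity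
  -- The integrand may blow up at d₁ = 2|A|; nonnegativity and continuity of the primitive up to the
  -- endpoint still give integrability.
  have hi := intervalIntegral.integrableOn_deriv_of_nonneg hc hd hn
  rw [← ofReal_integral_eq_lintegral_ofReal hi (ae_of_all _ fun x => by positivity),
    ← intervalIntegral.integral_of_le h12,
    intervalIntegral.integral_eq_sub_of_hasDerivAt_of_le h12 hc hd
      ((intervalIntegrable_iff_integrableOn_Ioc_of_le h12).2 hi)]

/-- For |B| ≤ 2|A| the function `logMeanCos A` is constant, and there the integrand is 0 because a
real square root of a nonpositive number is 0 and 1/0 = 0. Hence no case distinction is needed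
later. -/
lemma lintegral_one_div_sqrt_sq_sub_eq_logMeanCos {A d₁ d₂ : ℝ} (h : -(2 * |A|) ≤ d₁)
    (hpos : 0 < max d₁ (2 * |A|)) (h12 : d₁ ≤ d₂) :
    ∫⁻ x in Ioc d₁ d₂, ENNReal.ofReal (1 / √(x ^ 2 - 4 * A ^ 2)) =
      ENNReal.ofReal (logMeanCos A d₂ - logMeanCos A d₁) := by
  have hmax : ∀ d, d₁ ≤ d → max |d| (2 * |A|) = max d (2 * |A|) := fun d hd => by
    rcases le_total 0 d with h0 | h0
    · rw [abs_of_nonneg h0]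
    · rw [max_eq_right, max_eq_right]
      · linarith [abs_nonneg A]
      · rw [abs_of_nonpos h0]; linarith
  simp only [logMeanCos]
  rw [hmax d₁ le_rfl, hmax d₂ h12, ← lintegral_one_div_sqrt_sq_sub hpos (le_max_right _ _)
    (max_le_max_right _ h12)]
  have hzero : ∀ x, d₁ < x → x ≤ 2 * |A| → ENNReal.ofReal (1 / √(x ^ 2 - 4 * A ^ 2)) = 0 := by
    intro x hx hx'
    rw [Real.sqrt_eq_zero_of_nonpos, div_zero, ENNReal.ofReal_zero]
    rw [← sq_abs A]
    nlinarith
  rw [← lintegral_indicator measurableSet_Ioc, ← lintegral_indicator measurableSet_Ioc]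
  congr 1
  ext x
  simp only [indicator, mem_Ioc]
  split_ifs with ha hb hb
  · rfl
  · rw [hzero x ha.1]
    by_contra hcon
    exact hb ⟨max_lt ha.1 (not_le.1 hcon), ha.2.trans (le_max_left _ _)⟩
  · rcases le_or_gt x (2 * |A|) with hx | hx
    · exact (hzero x ((le_max_left _ _).trans_lt hb.1) hx).symm
    · refine absurd ⟨(le_max_left _ _).trans_lt hb.1, ?_⟩ ha
      rcases le_max_iff.1 hb.2 with h' | h'
      · exact h'
      · linarith
  · rfl

lemma logMeanCos_mono {A d₁ d₂ : ℝ} (h : -(2 * |A|) ≤ d₁)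
    (hpos : 0 < max d₁ (2 * |A|)) (h12 : d₁ ≤ d₂) : logMeanCos A d₁ ≤ logMeanCos A d₂ := by
  have hmax : max |d₁| (2 * |A|) ≤ max |d₂| (2 * |A|) := by
    refine max_le ?_ (le_max_right _ _)
    rcases le_total 0 d₁ with h0 | h0
    · rw [abs_of_nonneg h0]; exact h12.trans ((le_abs_self _).trans (le_max_left _ _))
    · rw [abs_of_nonpos h0]; exact le_trans (by linarith) (le_max_right _ _)
  have hpos' : 0 < max |d₁| (2 * |A|) := hpos.trans_le (max_le_max_right _ (le_abs_self _))
  apply Real.log_le_log (by positivity)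
  gcongr

/-- Integrating the derivative of `logMeanCos` along a line. -/
lemma lintegral_div_sqrt_affine_eq_logMeanCos {A k e a b : ℝ} (hk : 0 < k) (hab : a ≤ b)
    (h : -(2 * |A|) ≤ k * a + e) (hpos : 0 < max (k * a + e) (2 * |A|)) :
    ∫⁻ x in Ioc a b, ENNReal.ofReal (k / √((k * x + e) ^ 2 - 4 * A ^ 2)) =
      ENNReal.ofReal (logMeanCos A (k * b + e) - logMeanCos A (k * a + e)) := by
  have himg : (fun x => k * x + e) '' Ioc a b = Ioc (k * a + e) (k * b + e) :=
    image_affine_Ioc hk _ _ _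
  rw [← lintegral_one_div_sqrt_sq_sub_eq_logMeanCos h hpos (by gcongr), ← himg,
    lintegral_image_eq_lintegral_abs_deriv_mul measurableSet_Ioc (f' := fun _ => k)
      (fun x _ => by simpa using (((hasDerivAt_id x).const_mul k).add_const e).hasDerivWithinAt)
      (fun x _ y _ hxy => by simpa [hk.ne'] using hxy)]
  refine lintegral_congr fun x => ?_
  rw [abs_of_pos hk, ← ENNReal.ofReal_mul hk.le, mul_one_div]

/-! ### The fibre means and their derivatives in α -/

/-- The mean over `|y| = 1` of `log |Q_α(x, y)|`, `|x| = 1`, as a function of `z = |1 + x|²`. -/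
def meanQ (α z : ℝ) : ℝ := logMeanCos (z - 1) (α * √z)

/-- The mean over `|y| = 1` of `log |R_{α+2}(x, y)|`, `|x| = 1`, as a function of
`z = |1 + x|²`. -/
def meanR (α z : ℝ) : ℝ := logMeanCos (z - 1) (z ^ 2 + (α - 2) * z - 2)

/-- With A and B as in `meanR`, B - 2A = z(z + α - 4), and α ≥ 4 makes this nonnegative for every z
≥ 0. -/
lemma meanR_arg_ge {α z : ℝ} (hα : 4 ≤ α) (hz : 0 ≤ z) :
    2 * (z - 1) ≤ z ^ 2 + (α - 2) * z - 2 := by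
  nlinarith [mul_nonneg hz (sub_nonneg.2 hα), sq_nonneg z]

lemma neg_two_mul_abs_le_meanR_arg {α z : ℝ} (hα : 4 ≤ α) (hz : 0 ≤ z) :
    -(2 * |z - 1|) ≤ z ^ 2 + (α - 2) * z - 2 := by
  linarith [meanR_arg_ge hα hz, neg_abs_le (z - 1)]

lemma sq_div_two_le_meanR_arg (α z : ℝ) :
    z * (z + α - 4) / 2 ≤ max (z ^ 2 + (α - 2) * z - 2) (2 * |z - 1|) := by
  have h1 := le_max_left (z ^ 2 + (α - 2) * z - 2) (2 * |z - 1|)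
  have h2 := le_max_right (z ^ 2 + (α - 2) * z - 2) (2 * |z - 1|)
  have h3 := neg_abs_le (z - 1)
  nlinarith

lemma meanR_arg_pos {α z : ℝ} (hα : 4 ≤ α) (hz : 0 < z) :
    0 < max (z ^ 2 + (α - 2) * z - 2) (2 * |z - 1|) :=
  lt_of_lt_of_le (by have : 0 < z + α - 4 := by linarith
                     positivity) (sq_div_two_le_meanR_arg α z)

lemma lintegral_deriv_meanQ {a b z : ℝ} (ha : 0 < a) (hab : a ≤ b) (hz : 0 < z) :
    ∫⁻ α in Ioc a b, ENNReal.ofReal (√z / √(α ^ 2 * z - 4 * (z - 1) ^ 2)) =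
      ENNReal.ofReal (meanQ b z - meanQ a z) := by
  have hs : 0 < √z := Real.sqrt_pos.2 hz
  have h0 : 0 < √z * a + 0 := by positivity
  have := lintegral_div_sqrt_affine_eq_logMeanCos (A := z - 1) (e := 0) hs hab
    (by linarith [abs_nonneg (z - 1)]) (h0.trans_le (le_max_left _ _))
  simp only [add_zero, mul_pow, Real.sq_sqrt hz.le] at this
  simp only [meanQ, mul_comm a, mul_comm b, ← this, mul_comm z]

lemma lintegral_deriv_meanR {a b z : ℝ} (ha : 4 ≤ a) (hab : a ≤ b) (hz : 0 < z) :
    ∫⁻ α in Ioc a b, ENNReal.ofReal (z / √(z * (z + α - 4) * (z ^ 2 + α * z - 4))) =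
      ENNReal.ofReal (meanR b z - meanR a z) := by
  have e : ∀ α, z * α + (z ^ 2 - 2 * z - 2) = z ^ 2 + (α - 2) * z - 2 := fun α => by ring
  have := lintegral_div_sqrt_affine_eq_logMeanCos (A := z - 1) (e := z ^ 2 - 2 * z - 2) hz hab
    (by rw [e]; exact neg_two_mul_abs_le_meanR_arg ha hz.le) (by rw [e]; exact meanR_arg_pos ha hz)
  simp only [e] at this
  rw [meanR, meanR, ← this]
  refine lintegral_congr fun α => ?_
  congr 4
  ring

lemma meanQ_mono {a b z : ℝ} (ha : 0 < a) (hab : a ≤ b) (hz : 0 < z) : meanQ a z ≤ meanQ b z := by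
  have hs : 0 < √z := Real.sqrt_pos.2 hz
  have h0 : 0 < a * √z := by positivity
  exact logMeanCos_mono (by linarith [abs_nonneg (z - 1)]) (h0.trans_le (le_max_left _ _))
    (by gcongr)

lemma meanR_mono {a b z : ℝ} (ha : 4 ≤ a) (hab : a ≤ b) (hz : 0 < z) : meanR a z ≤ meanR b z :=
  logMeanCos_mono (neg_two_mul_abs_le_meanR_arg ha hz.le) (meanR_arg_pos ha hz) (by gcongr)

/-! ### Equality of the elliptic integrals -/

/-- The Möbius transformation `w ↦ ((α - 4) w + 4) / (1 + α - w)` identifies two elliptic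
integrals. -/
lemma lintegral_elliptic_eq {α : ℝ} (hα : 4 ≤ α) :
    ∫⁻ w in Ioo (0 : ℝ) 4, ENNReal.ofReal (2 / √((4 - w) * (α ^ 2 * w - 4 * (w - 1) ^ 2))) =
      ∫⁻ z in Ioo (0 : ℝ) 4, ENNReal.ofReal (2 / √((4 - z) * ((z + α - 4) * (z ^ 2 + α * z - 4)))) := by
  set N : ℝ → ℝ := fun w => ((α - 4) * w + 4) / (1 + α - w) with hN
  have hden : ∀ w ∈ Ioo (0 : ℝ) 4, 0 < 1 + α - w := fun w hw => by linarith [hw.2]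
  have hder : ∀ w ∈ Ioo (0 : ℝ) 4,
      HasDerivWithinAt N (α * (α - 3) / (1 + α - w) ^ 2) (Ioo 0 4) w := fun w hw => by
    have h1 : HasDerivAt (fun w : ℝ => (α - 4) * w + 4) (α - 4) w := by
      simpa using ((hasDerivAt_id w).const_mul (α - 4)).add_const 4
    have h2 : HasDerivAt (fun w : ℝ => 1 + α - w) (-1) w := by
      simpa using (hasDerivAt_id w).const_sub (1 + α)
    have := (h1.div h2 (hden w hw).ne').hasDerivWithinAt (s := Ioo 0 4)
    refine this.congr_deriv ?_
    congr 1
    ring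
  have hinj : InjOn N (Ioo 0 4) := by
    intro w hw v hv h
    have h1 := hden w hw
    have h2 := hden v hv
    simp only [hN] at h
    rw [div_eq_div_iff h1.ne' h2.ne'] at h
    have : α * (α - 3) * (w - v) = 0 := by linear_combination h
    have h3 : α * (α - 3) ≠ 0 := (mul_pos (by linarith) (by linarith)).ne'
    linarith [(mul_eq_zero.1 this).resolve_left h3]
  have himg : N '' Ioo 0 4 = Ioo (4 / (1 + α)) 4 := by
    have h1α : 0 < 1 + α := by linarith
    ext z
    constructor
    · rintro ⟨w, hw, rfl⟩
      have h1 := hden w hw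
      simp only [hN, mem_Ioo]
      rw [div_lt_div_iff₀ h1α h1, div_lt_iff₀ h1]
      constructor
      · nlinarith [mul_pos hw.1 (mul_pos (show 0 < α by linarith) (show 0 < α - 3 by linarith))]
      · nlinarith [hw.2]
    · rintro ⟨hz1, hz2⟩
      rw [div_lt_iff₀ h1α] at hz1
      have hz0 : 0 < z := by nlinarith
      have hs : 0 < z + α - 4 := by linarith
      have hs' : 0 < α * (α - 3) := mul_pos (by linarith) (by linarith)
      -- The witness is the inverse Möbius map.
      refine ⟨((1 + α) * z - 4) / (z + α - 4), ⟨div_pos (by linarith) hs, ?_⟩, ?_⟩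
      · rw [div_lt_iff₀ hs]
        nlinarith
      · have e : 1 + α - ((1 + α) * z - 4) / (z + α - 4) = α * (α - 3) / (z + α - 4) := by
          field_simp
          ring
        simp only [hN]
        rw [e]
        have : α ≠ 0 := by linarith
        have : α - 3 ≠ 0 := by linarith
        field_simp
        ring
  -- The image of N misses (0, 4/(1 + α)], but there z² + αz - 4 ≤ 0, so the radicand is nonpositive
  -- and the integrand is 0 by convention.
  have hrestrict : ∫⁻ z in Ioo (0 : ℝ) 4,
      ENNReal.ofReal (2 / √((4 - z) * ((z + α - 4) * (z ^ 2 + α * z - 4)))) =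
      ∫⁻ z in Ioo (4 / (1 + α)) 4,
        ENNReal.ofReal (2 / √((4 - z) * ((z + α - 4) * (z ^ 2 + α * z - 4)))) := by
    have h1α : 0 < 1 + α := by linarith
    rw [← lintegral_indicator measurableSet_Ioo, ← lintegral_indicator measurableSet_Ioo]
    congr 1
    ext z
    have hpos : 0 < 4 / (1 + α) := by positivity
    by_cases hz : z ∈ Ioo (4 / (1 + α)) 4
    · rw [indicator_of_mem hz, indicator_of_mem (Ioo_subset_Ioo_left hpos.le hz)]
    rw [indicator_of_notMem hz]
    refine indicator_apply_eq_zero.2 fun hz0 => ?_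
    obtain ⟨hz0, hz4⟩ := hz0
    have hz' : z ≤ 4 / (1 + α) := by
      by_contra hcon
      exact hz ⟨not_le.1 hcon, hz4⟩
    rw [le_div_iff₀ h1α] at hz'
    have : z ≤ 1 := by nlinarith
    have hneg : z ^ 2 + α * z - 4 ≤ 0 := by nlinarith
    rw [Real.sqrt_eq_zero_of_nonpos, div_zero, ENNReal.ofReal_zero]
    exact mul_nonpos_of_nonneg_of_nonpos (by linarith)
      (mul_nonpos_of_nonneg_of_nonpos (by linarith) hneg)
  rw [hrestrict, ← himg, lintegral_image_eq_lintegral_abs_deriv_mul measurableSet_Ioo hder hinj]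
  refine setLIntegral_congr_fun measurableSet_Ioo fun w hw => ?_
  have h1 := hden w hw
  have hc : 0 < α * (α - 3) := mul_pos (by linarith) (by linarith)
  have hJ : 0 < α * (α - 3) / (1 + α - w) ^ 2 := by positivity
  rw [abs_of_pos hJ, ← ENNReal.ofReal_mul hJ.le]
  congr 1
  -- N fixes 4, sends ∞ to 4 - α, and sends the roots of α²w - 4(w - 1)² to those of z² + αz - 4.
  -- The remaining factor is exactly the squared Jacobian.
  have hpoly : (4 - N w) * ((N w + α - 4) * (N w ^ 2 + α * N w - 4)) =
      (α * (α - 3) / (1 + α - w) ^ 2) ^ 2 * ((4 - w) * (α ^ 2 * w - 4 * (w - 1) ^ 2)) := by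
    simp only [hN]
    field_simp
    ring
  rw [hpoly, Real.sqrt_mul (sq_nonneg _), Real.sqrt_sq hJ.le, ← mul_div_assoc,
    mul_div_mul_left _ _ hJ.ne']

/-- The factor 2 arises because θ and 2π - θ give the same z. -/
lemma lintegral_comp_two_add_two_mul_cos (f : ℝ → ENNReal) :
    ∫⁻ θ in Ioc 0 (2 * π), f (2 + 2 * cos θ) =
      ∫⁻ z in Ioo (0 : ℝ) 4, ENNReal.ofReal (2 / √(z * (4 - z))) * f z := by
  have hmem : ∀ θ ∈ Ioo 0 π, 2 + 2 * cos θ ∈ Ioo (0 : ℝ) 4 := fun θ hθ => by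
    have h1 : cos θ < 1 := by
      simpa using Real.cos_lt_cos_of_nonneg_of_le_pi le_rfl hθ.2.le hθ.1
    have h2 : -1 < cos θ := by
      simpa using Real.cos_lt_cos_of_nonneg_of_le_pi hθ.1.le le_rfl hθ.2
    constructor <;> linarith
  have himg : (fun θ => 2 + 2 * cos θ) '' Ioo 0 π = Ioo (0 : ℝ) 4 := by
    refine Subset.antisymm (image_subset_iff.2 hmem) fun z hz => ?_
    have h1 : -1 < (z - 2) / 2 := by linarith [hz.1]
    have h2 : (z - 2) / 2 < 1 := by linarith [hz.2]
    refine ⟨arccos ((z - 2) / 2), ⟨arccos_pos.2 h2, ?_⟩, ?_⟩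
    · refine lt_of_le_of_ne (arccos_le_pi _) fun h => ?_
      rw [arccos_eq_pi] at h
      linarith
    · simp only
      rw [cos_arccos h1.le h2.le]
      ring
  have hhalf : ∫⁻ θ in Ioo 0 π, f (2 + 2 * cos θ) =
      ∫⁻ z in Ioo (0 : ℝ) 4, ENNReal.ofReal (1 / √(z * (4 - z))) * f z := by
    rw [← himg, lintegral_image_eq_lintegral_abs_deriv_mul measurableSet_Ioo
      (f' := fun θ => -(2 * sin θ))
      (fun θ _ => by
        simpa using (((Real.hasDerivAt_cos θ).const_mul 2).const_add 2).hasDerivWithinAt)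
      (fun x hx y hy hxy => Real.injOn_cos (Ioo_subset_Icc_self hx) (Ioo_subset_Icc_self hy)
        (by simpa using hxy))]
    refine setLIntegral_congr_fun measurableSet_Ioo fun θ hθ => ?_
    have hs : 0 < 2 * sin θ := mul_pos two_pos (sin_pos_of_mem_Ioo hθ)
    have e : (2 + 2 * cos θ) * (4 - (2 + 2 * cos θ)) = (2 * sin θ) ^ 2 := by
      linear_combination (-4) * sin_sq_add_cos_sq θ
    rw [← mul_assoc, ← ENNReal.ofReal_mul (abs_nonneg _), e, Real.sqrt_sq hs.le, abs_neg,
      abs_of_pos hs, mul_one_div_cancel hs.ne', ENNReal.ofReal_one, one_mul]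
  have hrefl : ∫⁻ θ in Ioo π (2 * π), f (2 + 2 * cos θ) = ∫⁻ θ in Ioo 0 π, f (2 + 2 * cos θ) := by
    have : (fun θ : ℝ => 2 * π - θ) '' Ioo 0 π = Ioo π (2 * π) := by
      rw [image_const_sub_Ioo]
      congr 1 <;> ring
    rw [← this, lintegral_image_eq_lintegral_abs_deriv_mul measurableSet_Ioo (f' := fun _ => -1)
      (fun θ _ => by simpa using ((hasDerivAt_id θ).const_sub (2 * π)).hasDerivWithinAt)
      (fun x _ y _ hxy => by simpa using hxy)]
    refine lintegral_congr fun θ => ?_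
    simp
  have hunion : Ioc 0 (2 * π) = Ioc 0 π ∪ Ioc π (2 * π) :=
    (Ioc_union_Ioc_eq_Ioc pi_pos.le (by linarith [pi_pos])).symm
  rw [hunion, lintegral_union measurableSet_Ioc (Ioc_disjoint_Ioc_of_le le_rfl),
    setLIntegral_congr Ioo_ae_eq_Ioc.symm, setLIntegral_congr (Ioo_ae_eq_Ioc (a := π)).symm, hrefl,
    hhalf, ← two_mul, ← lintegral_const_mul' _ _ ENNReal.ofNat_ne_top]
  refine lintegral_congr fun z => ?_
  rw [← mul_assoc, show (2 : ENNReal) = ENNReal.ofReal 2 by simp,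
    ← ENNReal.ofReal_mul zero_le_two, mul_one_div]

lemma two_div_sqrt_mul_sqrt_div {z p : ℝ} (hz : z ∈ Ioo (0 : ℝ) 4) :
    2 / √(z * (4 - z)) * (√z / √p) = 2 / √((4 - z) * p) := by
  have h1 : 0 < √z := Real.sqrt_pos.2 hz.1
  have h4 : 0 < 4 - z := sub_pos.2 hz.2
  have h2 : 0 < √(4 - z) := Real.sqrt_pos.2 h4
  rw [Real.sqrt_mul hz.1.le, Real.sqrt_mul h4.le, div_mul_div_comm,
    show √z * √(4 - z) * √p = √z * (√(4 - z) * √p) by ring, mul_comm 2,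
    mul_div_mul_left _ _ h1.ne']

/-- Each difference is an integral over α; Tonelli moves that integral outside, where the elliptic
integrals agree for each α. With nonnegative extended values only measurability has to be checked.
-/
theorem lintegral_meanQ_sub_eq_lintegral_meanR_sub {a b : ℝ} (ha : 4 ≤ a) (hab : a ≤ b) :
    ∫⁻ θ in Ioc 0 (2 * π), ENNReal.ofReal
        (meanQ b (2 + 2 * cos θ) - meanQ a (2 + 2 * cos θ)) =
      ∫⁻ θ in Ioc 0 (2 * π), ENNReal.ofReal
        (meanR b (2 + 2 * cos θ) - meanR a (2 + 2 * cos θ)) := by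
  rw [lintegral_comp_two_add_two_mul_cos fun z => ENNReal.ofReal (meanQ b z - meanQ a z),
    lintegral_comp_two_add_two_mul_cos fun z => ENNReal.ofReal (meanR b z - meanR a z)]
  have hQ : ∀ z ∈ Ioo (0 : ℝ) 4,
      ENNReal.ofReal (2 / √(z * (4 - z))) * ENNReal.ofReal (meanQ b z - meanQ a z) =
      ∫⁻ α in Ioc a b,
        ENNReal.ofReal (2 / √((4 - z) * (α ^ 2 * z - 4 * (z - 1) ^ 2))) := fun z hz => by
    rw [← lintegral_deriv_meanQ (by linarith) hab hz.1,
      ← lintegral_const_mul' _ _ ENNReal.ofReal_ne_top]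
    refine lintegral_congr fun α => ?_
    rw [← ENNReal.ofReal_mul (by positivity), two_div_sqrt_mul_sqrt_div hz]
  have hR : ∀ z ∈ Ioo (0 : ℝ) 4,
      ENNReal.ofReal (2 / √(z * (4 - z))) * ENNReal.ofReal (meanR b z - meanR a z) =
      ∫⁻ α in Ioc a b,
        ENNReal.ofReal (2 / √((4 - z) * ((z + α - 4) * (z ^ 2 + α * z - 4)))) := fun z hz => by
    rw [← lintegral_deriv_meanR ha hab hz.1,
      ← lintegral_const_mul' _ _ ENNReal.ofReal_ne_top]
    refine lintegral_congr fun α => ?_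
    rw [← ENNReal.ofReal_mul (by positivity), mul_assoc z,
      Real.sqrt_mul hz.1.le ((z + α - 4) * _), ← div_div z, Real.div_sqrt, two_div_sqrt_mul_sqrt_div hz]
  rw [setLIntegral_congr_fun measurableSet_Ioo hQ, setLIntegral_congr_fun measurableSet_Ioo hR]
  refine (lintegral_lintegral_swap (by unfold Function.uncurry; fun_prop)).trans
    ((setLIntegral_congr_fun measurableSet_Ioc fun α hα => ?_).trans
      (lintegral_lintegral_swap (by unfold Function.uncurry; fun_prop)).symm)
  exact lintegral_elliptic_eq (ha.trans hα.1.le)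

/-! ### The mean of log |1 + x|² -/

lemma integrableOn_log_two_add_two_mul_cos :
    IntegrableOn (fun θ => log (2 + 2 * cos θ)) (Ioc 0 (2 * π)) := by
  have := (intervalIntegrable_iff_integrableOn_Ioc_of_le two_pi_pos.le).1
    (intervalIntegrable_log_abs_two_mul_cos_add 1 2 0 (2 * π))
  simpa [Real.log_abs, add_comm] using this

lemma integral_log_two_add_two_mul_cos :
    ∫ θ in Ioc 0 (2 * π), log (2 + 2 * cos θ) = 0 := by
  have h := integral_log_abs_two_mul_cos_add 1 2
  rw [intervalIntegral.integral_of_le two_pi_pos.le] at h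
  have h0 : logMeanCos 1 2 = 0 := by norm_num [logMeanCos]
  rw [h0, mul_zero] at h
  simpa [Real.log_abs, add_comm] using h

lemma two_add_two_mul_cos_le (θ : ℝ) : 2 + 2 * cos θ ≤ 4 := by linarith [cos_le_one θ]

lemma ae_two_add_two_mul_cos_pos :
    ∀ᵐ θ ∂volume.restrict (Ioc 0 (2 * π)), 0 < 2 + 2 * cos θ := by
  have hne : ∀ᵐ θ : ℝ ∂volume.restrict (Ioc 0 (2 * π)), θ ≠ π :=
    ae_restrict_of_ae (by simp [ae_iff])
  filter_upwards [hne, ae_restrict_mem measurableSet_Ioc] with θ h1 h2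
  have h3 : 2 + 2 * cos θ ≠ 0 := fun h => by
    have h4 : cos θ = -1 := by linarith
    obtain ⟨k, hk⟩ := cos_eq_neg_one_iff.1 h4
    have hk0 : k = 0 := by
      have h5 : (-1 : ℝ) < k := by nlinarith [pi_pos, h2.1]
      have h6 : (k : ℝ) < 1 := by nlinarith [pi_pos, h2.2]
      have h7 : -1 < k := by exact_mod_cast h5
      have h8 : k < 1 := by exact_mod_cast h6
      omega
    rw [hk0] at hk
    exact h1 (by simpa using hk.symm)
  exact lt_of_le_of_ne (by linarith [neg_one_le_cos θ]) h3.symm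

/-! ### Asymptotics and uniform bounds for large parameters -/

lemma logMeanCos_div {A B b : ℝ} (hb : 0 < b) (hpos : 0 < max |B| (2 * |A|)) :
    logMeanCos (A / b) (B / b) = logMeanCos A B - log b := by
  have hm : max |B / b| (2 * |A / b|) = max |B| (2 * |A|) / b := by
    rw [abs_div, abs_div, abs_of_pos hb, ← mul_div_assoc, max_div_div_right hb.le]
  have hs : √((max |B| (2 * |A|) / b) ^ 2 - 4 * (A / b) ^ 2) =
      √(max |B| (2 * |A|) ^ 2 - 4 * A ^ 2) / b := by
    rw [div_pow, div_pow, ← mul_div_assoc, ← sub_div, Real.sqrt_div' _ (sq_nonneg b),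
      Real.sqrt_sq hb.le]
  have := Real.sqrt_nonneg (max |B| (2 * |A|) ^ 2 - 4 * A ^ 2)
  rw [logMeanCos, logMeanCos, hm, hs, ← Real.log_div (by positivity) hb.ne']
  congr 1
  ring

lemma tendsto_logMeanCos {ι : Type*} {l : Filter ι} {A B : ι → ℝ} {B₀ : ℝ} (hB₀ : 0 < B₀)
    (hA : Tendsto A l (𝓝 0)) (hB : Tendsto B l (𝓝 B₀)) :
    Tendsto (fun i => logMeanCos (A i) (B i)) l (𝓝 (log B₀)) := by
  have h := (continuous_arg_logMeanCos.tendsto (0, B₀)).comp (hA.prodMk_nhds hB)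
  have hval : (max |B₀| (2 * |(0 : ℝ)|) + √(max |B₀| (2 * |(0 : ℝ)|) ^ 2 - 4 * (0 : ℝ) ^ 2)) / 2
      = B₀ := by
    simp [abs_of_pos hB₀, Real.sqrt_sq hB₀.le, hB₀.le]
  simp only [hval] at h
  exact h.log hB₀.ne'

lemma tendsto_meanQ_sub_log {z : ℝ} (hz : 0 < z) :
    Tendsto (fun b => meanQ b z - log b) atTop (𝓝 (log z / 2)) := by
  rw [← Real.log_sqrt hz.le]
  have hs : 0 < √z := Real.sqrt_pos.2 hz
  refine (tendsto_logMeanCos hs (A := fun b => (z - 1) / b) (B := fun _ => √z)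
    (tendsto_const_nhds.div_atTop tendsto_id) tendsto_const_nhds).congr' ?_
  filter_upwards [eventually_gt_atTop 0] with b hb
  rw [meanQ, ← logMeanCos_div hb (lt_max_of_lt_left (by positivity)), mul_div_cancel_left₀ _ hb.ne']

lemma tendsto_meanR_sub_log {z : ℝ} (hz : 0 < z) :
    Tendsto (fun b => meanR b z - log b) atTop (𝓝 (log z)) := by
  refine (tendsto_logMeanCos hz (A := fun b => (z - 1) / b)
    (B := fun b => z + (z ^ 2 - 2 * z - 2) / b)
    (tendsto_const_nhds.div_atTop tendsto_id) ?_).congr' ?_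
  · simpa using (tendsto_const_nhds (x := z)).add
      ((tendsto_const_nhds (x := z ^ 2 - 2 * z - 2)).div_atTop (tendsto_id (α := ℝ)))
  filter_upwards [eventually_ge_atTop 4] with b hb
  have hb0 : 0 < b := by linarith
  rw [meanR, ← logMeanCos_div hb0
    ((meanR_arg_pos hb hz).trans_le (max_le_max_right _ (le_abs_self _)))]
  congr 1
  field_simp
  ring

lemma le_meanQ {α z : ℝ} (hα : 0 < α) (hz : 0 < z) :
    log α + log z / 2 - log 2 ≤ meanQ α z := by
  have hs : 0 < √z := Real.sqrt_pos.2 hz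
  have h0 : 0 < α * √z := by positivity
  have := log_half_le_logMeanCos (A := z - 1) (B := α * √z) h0 ((le_abs_self _).trans (le_max_left _ _))
  rwa [Real.log_div h0.ne' two_ne_zero, Real.log_mul hα.ne' hs.ne', Real.log_sqrt hz.le] at this

lemma meanQ_le {α z : ℝ} (hα : 0 < α) (hz : 0 < z) (hz4 : z ≤ 4) :
    meanQ α z ≤ log (2 * α + 6) := by
  have hs : 0 < √z := Real.sqrt_pos.2 hz
  have hs2 : √z ≤ 2 := Real.sqrt_le_iff.2 ⟨by norm_num, by linarith⟩
  have h0 : 0 < α * √z := by positivity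
  refine logMeanCos_le_log (lt_max_of_lt_left (abs_pos.2 h0.ne')) (max_le ?_ ?_)
  · rw [abs_of_pos h0]; nlinarith
  · have : |z - 1| ≤ 3 := abs_le.2 ⟨by linarith, by linarith⟩
    linarith

lemma le_meanR {α z : ℝ} (hα : 4 ≤ α) (hz : 0 < z) :
    log z + log (z + α - 4) - log 4 ≤ meanR α z := by
  have h1 : 0 < z + α - 4 := by linarith
  have h0 : 0 < z * (z + α - 4) / 2 := by positivity
  have := log_half_le_logMeanCos (A := z - 1) h0 ((sq_div_two_le_meanR_arg α z).trans
    (max_le_max_right _ (le_abs_self _)))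
  rwa [div_div, Real.log_div (by positivity) (by norm_num), Real.log_mul hz.ne' h1.ne',
    show (2 * 2 : ℝ) = 4 by norm_num] at this

lemma meanR_le {α z : ℝ} (hα : 4 ≤ α) (hz : 0 < z) (hz4 : z ≤ 4) :
    meanR α z ≤ log (4 * α + 6) := by
  refine logMeanCos_le_log
    ((meanR_arg_pos hα hz).trans_le (max_le_max_right _ (le_abs_self _))) (max_le ?_ ?_)
  · have := meanR_arg_ge hα hz.le
    exact abs_le.2 ⟨by linarith, by nlinarith⟩
  · have : |z - 1| ≤ 3 := abs_le.2 ⟨by linarith, by linarith⟩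
    linarith

/-- The bound does not depend on b, so it serves for dominated convergence. -/
lemma abs_meanQ_sub_log_le {b z : ℝ} (hb : 4 ≤ b) (hz : 0 < z) (hz4 : z ≤ 4) :
    |meanQ b z - log b| ≤ |log z| + log 8 := by
  have h1 := le_meanQ (by linarith : 0 < b) hz
  have h2 := meanQ_le (by linarith : 0 < b) hz hz4
  have h3 : log (2 * b + 6) ≤ log (8 * b) := Real.log_le_log (by linarith) (by linarith)
  rw [Real.log_mul (by norm_num) (by linarith)] at h3
  have h4 : log 2 ≤ log 8 := Real.log_le_log (by norm_num) (by norm_num)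
  have h5 := neg_abs_le (log z)
  have h6 := abs_nonneg (log z)
  exact abs_le.2 ⟨by linarith, by linarith⟩

lemma abs_meanR_sub_log_le {b z : ℝ} (hb : 8 ≤ b) (hz : 0 < z) (hz4 : z ≤ 4) :
    |meanR b z - log b| ≤ |log z| + log 8 := by
  have h1 := le_meanR (by linarith : 4 ≤ b) hz
  have h2 := meanR_le (by linarith : 4 ≤ b) hz hz4
  have h3 : log (4 * b + 6) ≤ log (8 * b) := Real.log_le_log (by linarith) (by linarith)
  rw [Real.log_mul (by norm_num) (by linarith)] at h3
  -- Here b ≥ 8 is used: b - 4 ≥ b/2.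
  have h4 : log (b / 2) ≤ log (z + b - 4) := Real.log_le_log (by linarith) (by linarith)
  rw [Real.log_div (by linarith) (by norm_num)] at h4
  have h5 := neg_abs_le (log z)
  have h6 := abs_nonneg (log z)
  have h7 : log 8 = log 2 + log 4 := by
    rw [← Real.log_mul (by norm_num) (by norm_num)]; norm_num
  exact abs_le.2 ⟨by linarith, by linarith⟩

/-- The factor 2 is for α near 4: at α = 4 the lower bound contains log z twice. -/
lemma abs_meanR_le {α z : ℝ} (hα : 4 ≤ α) (hz : 0 < z) (hz4 : z ≤ 4) :
    |meanR α z| ≤ 2 * |log z| + log (4 * α + 6) := by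
  have h1 := le_meanR hα hz
  have h2 := meanR_le hα hz hz4
  have h3 : log z ≤ log (z + α - 4) := Real.log_le_log hz (by linarith)
  have h4 : log 4 ≤ log (4 * α + 6) := Real.log_le_log (by norm_num) (by linarith)
  have h5 := neg_abs_le (log z)
  have h6 := abs_nonneg (log z)
  exact abs_le.2 ⟨by linarith, by linarith⟩

/-! ### Integration over θ and the limit at infinity -/

lemma measurable_meanQ (α : ℝ) : Measurable (meanQ α) :=
  measurable_logMeanCos.comp (Measurable.prodMk (by fun_prop) (by fun_prop))

lemma measurable_meanR (α : ℝ) : Measurable (meanR α) :=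
  measurable_logMeanCos.comp (Measurable.prodMk (by fun_prop) (by fun_prop))

lemma integrableOn_meanQ {α : ℝ} (hα : 4 ≤ α) :
    IntegrableOn (fun θ => meanQ α (2 + 2 * cos θ)) (Ioc 0 (2 * π)) := by
  have hdom : IntegrableOn (fun θ => |log (2 + 2 * cos θ)| + (log 8 + |log α|))
      (Ioc 0 (2 * π)) := integrableOn_log_two_add_two_mul_cos.abs.add (integrable_const _)
  refine hdom.mono' ((measurable_meanQ α).comp (by fun_prop)).aestronglyMeasurable ?_
  filter_upwards [ae_two_add_two_mul_cos_pos] with θ hθ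
  have h1 := abs_meanQ_sub_log_le hα hθ (two_add_two_mul_cos_le θ)
  have h2 := abs_sub_abs_le_abs_sub (meanQ α (2 + 2 * cos θ)) (log α)
  rw [norm_eq_abs]
  linarith

lemma integrableOn_meanR {α : ℝ} (hα : 4 ≤ α) :
    IntegrableOn (fun θ => meanR α (2 + 2 * cos θ)) (Ioc 0 (2 * π)) := by
  have hdom : IntegrableOn (fun θ => 2 * |log (2 + 2 * cos θ)| + log (4 * α + 6))
      (Ioc 0 (2 * π)) :=
    (integrableOn_log_two_add_two_mul_cos.abs.const_mul 2).add (integrable_const _)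
  refine hdom.mono' ((measurable_meanR α).comp (by fun_prop)).aestronglyMeasurable ?_
  filter_upwards [ae_two_add_two_mul_cos_pos] with θ hθ
  exact abs_meanR_le hα hθ (two_add_two_mul_cos_le θ)

lemma tendsto_integral_meanQ_sub_log :
    Tendsto (fun b => ∫ θ in Ioc 0 (2 * π), (meanQ b (2 + 2 * cos θ) - log b)) atTop (𝓝 0) := by
  have h0 : ∫ θ in Ioc 0 (2 * π), log (2 + 2 * cos θ) / 2 = 0 := by
    rw [integral_div, integral_log_two_add_two_mul_cos, zero_div]
  suffices h : Tendsto (fun b => ∫ θ in Ioc 0 (2 * π), (meanQ b (2 + 2 * cos θ) - log b)) atTop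
      (𝓝 (∫ θ in Ioc 0 (2 * π), log (2 + 2 * cos θ) / 2)) by rwa [h0] at h
  refine tendsto_integral_filter_of_dominated_convergence
    (fun θ => |log (2 + 2 * cos θ)| + log 8) ?_ ?_
    (integrableOn_log_two_add_two_mul_cos.abs.add (integrable_const _)) ?_
  · exact Eventually.of_forall fun b =>
      (((measurable_meanQ b).comp (by fun_prop)).sub_const _).aestronglyMeasurable
  · filter_upwards [eventually_ge_atTop 4] with b hb
    filter_upwards [ae_two_add_two_mul_cos_pos] with θ hθ
    exact abs_meanQ_sub_log_le hb hθ (two_add_two_mul_cos_le θ)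
  · filter_upwards [ae_two_add_two_mul_cos_pos] with θ hθ
    exact tendsto_meanQ_sub_log hθ

lemma tendsto_integral_meanR_sub_log :
    Tendsto (fun b => ∫ θ in Ioc 0 (2 * π), (meanR b (2 + 2 * cos θ) - log b)) atTop (𝓝 0) := by
  suffices h : Tendsto (fun b => ∫ θ in Ioc 0 (2 * π), (meanR b (2 + 2 * cos θ) - log b)) atTop
      (𝓝 (∫ θ in Ioc 0 (2 * π), log (2 + 2 * cos θ))) by
    rwa [integral_log_two_add_two_mul_cos] at h
  refine tendsto_integral_filter_of_dominated_convergence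
    (fun θ => |log (2 + 2 * cos θ)| + log 8) ?_ ?_
    (integrableOn_log_two_add_two_mul_cos.abs.add (integrable_const _)) ?_
  · exact Eventually.of_forall fun b =>
      (((measurable_meanR b).comp (by fun_prop)).sub_const _).aestronglyMeasurable
  · filter_upwards [eventually_ge_atTop 8] with b hb
    filter_upwards [ae_two_add_two_mul_cos_pos] with θ hθ
    exact abs_meanR_sub_log_le hb hθ (two_add_two_mul_cos_le θ)
  · filter_upwards [ae_two_add_two_mul_cos_pos] with θ hθ
    exact tendsto_meanR_sub_log hθ

lemma integral_meanQ_sub_eq_integral_meanR_sub {a b : ℝ} (ha : 4 ≤ a) (hab : a ≤ b) :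
    (∫ θ in Ioc 0 (2 * π), meanQ b (2 + 2 * cos θ)) - ∫ θ in Ioc 0 (2 * π), meanQ a (2 + 2 * cos θ)
      = (∫ θ in Ioc 0 (2 * π), meanR b (2 + 2 * cos θ)) -
        ∫ θ in Ioc 0 (2 * π), meanR a (2 + 2 * cos θ) := by
  have hb := ha.trans hab
  rw [← integral_sub (integrableOn_meanQ hb) (integrableOn_meanQ ha),
    ← integral_sub (integrableOn_meanR hb) (integrableOn_meanR ha),
    integral_eq_lintegral_of_nonneg_ae, integral_eq_lintegral_of_nonneg_ae,
    lintegral_meanQ_sub_eq_lintegral_meanR_sub ha hab]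
  · filter_upwards [ae_two_add_two_mul_cos_pos] with θ hθ
    exact sub_nonneg.2 (meanR_mono ha hab hθ)
  · exact ((integrableOn_meanR hb).sub (integrableOn_meanR ha)).aestronglyMeasurable
  · filter_upwards [ae_two_add_two_mul_cos_pos] with θ hθ
    exact sub_nonneg.2 (meanQ_mono (by linarith) hab hθ)
  · exact ((integrableOn_meanQ hb).sub (integrableOn_meanQ ha)).aestronglyMeasurable

/-- The difference of the two integrals at b does not depend on b ≥ α, and the log b terms cancel,
so it equals its limit 0. -/
theorem integral_meanQ_eq_integral_meanR {α : ℝ} (hα : 4 ≤ α) :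
    ∫ θ in Ioc 0 (2 * π), meanQ α (2 + 2 * cos θ) =
      ∫ θ in Ioc 0 (2 * π), meanR α (2 + 2 * cos θ) := by
  have h := tendsto_integral_meanQ_sub_log.sub tendsto_integral_meanR_sub_log
  rw [sub_zero] at h
  refine sub_eq_zero.1 (tendsto_nhds_unique (tendsto_const_nhds.congr' ?_) h)
  filter_upwards [eventually_ge_atTop α] with b hb
  have hb4 := hα.trans hb
  rw [integral_sub (integrableOn_meanQ hb4) (integrable_const _),
    integral_sub (integrableOn_meanR hb4) (integrable_const _)]
  linarith [integral_meanQ_sub_eq_integral_meanR_sub hα hb]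

/-! ### From fibre means to the torus -/

/-- A function bounded above whose slices are integrable is integrable as soon as the integrals of
its slices are. -/
lemma integrable_prod_of_le_of_integrable_integral {X Y : Type*} [MeasurableSpace X]
    [MeasurableSpace Y] {μ : Measure X} {ν : Measure Y} [IsFiniteMeasure μ] [IsFiniteMeasure ν]
    {f : X × Y → ℝ} (hf : Measurable f) {K : ℝ} (hK : ∀ p, f p ≤ K) (hK0 : 0 ≤ K)
    (hslice : ∀ x, Integrable (fun y => f (x, y)) ν)
    (hint : Integrable (fun x => ∫ y, f (x, y) ∂ν) μ) : Integrable f (μ.prod ν) := by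
  rw [integrable_prod_iff hf.aestronglyMeasurable]
  refine ⟨ae_of_all _ hslice, ?_⟩
  -- From f ≤ K and K ≥ 0 follows |f| ≤ 2K - f, whose slice integrals are controlled by those of f.
  have hdom : Integrable (fun x => (∫ _, 2 * K ∂ν) - ∫ y, f (x, y) ∂ν) μ :=
    (integrable_const _).sub hint
  refine hdom.mono' hf.norm.aestronglyMeasurable.integral_prod_right' (ae_of_all _ fun x => ?_)
  rw [norm_of_nonneg (integral_nonneg fun y => norm_nonneg _),
    ← integral_sub (integrable_const _) (hslice x)]
  refine integral_mono (hslice x).norm ((integrable_const _).sub (hslice x)) fun y => ?_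
  rw [norm_eq_abs]
  exact abs_le'.2 ⟨by linarith [hK (x, y)], by linarith⟩

/-- Mahler measure of a polynomial in two variables which, on the unit torus, is up to a factor of
modulus one of the form `2 A(θ) cos (φ - s(θ)) + B(θ)`. -/
theorem mahler_of_norm_eval_eq {P : MvPolynomial (Fin 2) ℂ} {A B s : ℝ → ℝ} (hA : Continuous A)
    (hB : Continuous B) (hs : Continuous s) {M : ℝ} (hM : ∀ θ, 2 * |A θ| + |B θ| ≤ M)
    (hP : ∀ θ : Fin 2 → ℝ, ‖MvPolynomial.eval (torusMap 0 1 θ) P‖ =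
      |2 * A (θ 0) * cos (θ 1 - s (θ 0)) + B (θ 0)|)
    (hint : IntegrableOn (fun θ => logMeanCos (A θ) (B θ)) (Ioc 0 (2 * π))) :
    MahlerIntegrable P ∧
      mahlerMeasureLog P = (2 * π)⁻¹ * ∫ θ in Ioc 0 (2 * π), logMeanCos (A θ) (B θ) := by
  set f : ℝ × ℝ → ℝ := fun p => log |2 * A p.1 * cos (p.2 - s p.1) + B p.1| with hf
  have hfm : Measurable f := Real.measurable_log.comp (by fun_prop : Continuous _).measurable
  set e := MeasurableEquiv.finTwoArrow (α := ℝ)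
  have hmp : MeasurePreserving e := volume_preserving_finTwoArrow ℝ
  have hpre : Icc (0 : Fin 2 → ℝ) (fun _ => 2 * π) =
      e ⁻¹' (Icc 0 (2 * π) ×ˢ Icc 0 (2 * π)) := by
    ext θ
    simp only [e, mem_Icc, Pi.le_def, Fin.forall_fin_two, mem_preimage, mem_prod,
      MeasurableEquiv.finTwoArrow_apply, Pi.zero_apply]
    tauto
  have hcomp : (fun θ : Fin 2 → ℝ => log ‖MvPolynomial.eval (torusMap 0 1 θ) P‖) = f ∘ e := by
    ext θ
    simp only [hP, hf, e, Function.comp_apply, MeasurableEquiv.finTwoArrow_apply]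
  have hslice : ∀ x, ∫ y in Ioc 0 (2 * π), f (x, y) = 2 * π * logMeanCos (A x) (B x) := fun x => by
    rw [← intervalIntegral.integral_of_le two_pi_pos.le]
    exact integral_log_abs_two_mul_cos_sub_add (A x) (B x) (s x)
  have hM0 : 0 ≤ M := le_trans (by positivity) (hM 0)
  have hK : ∀ p, f p ≤ M := fun p => by
    refine (Real.log_le_self (abs_nonneg _)).trans ((abs_add_le _ _).trans (le_trans ?_ (hM p.1)))
    have h2 : |2 * A p.1| = 2 * |A p.1| := by rw [abs_mul, abs_two]
    rw [abs_mul, ← h2]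
    gcongr
    exact mul_le_of_le_one_right (by positivity) (abs_cos_le_one _)
  have hprod : Integrable f
      ((volume.restrict (Ioc 0 (2 * π))).prod (volume.restrict (Ioc 0 (2 * π)))) := by
    refine integrable_prod_of_le_of_integrable_integral hfm hK hM0 (fun x => ?_) ?_
    · have := (intervalIntegrable_log_abs_two_mul_cos_add (A x) (B x) (0 - s x)
        (2 * π - s x)).comp_sub_right (s x)
      rw [sub_add_cancel, sub_add_cancel] at this
      exact (intervalIntegrable_iff_integrableOn_Ioc_of_le two_pi_pos.le).1 this
    · simp only [hslice]
      exact hint.const_mul _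
  have hIcc : (volume.restrict (Icc 0 (2 * π) ×ˢ Icc 0 (2 * π)) : Measure (ℝ × ℝ)) =
      (volume.restrict (Ioc 0 (2 * π))).prod (volume.restrict (Ioc 0 (2 * π))) := by
    rw [Measure.volume_eq_prod, ← Measure.prod_restrict, restrict_Ioc_eq_restrict_Icc]
  constructor
  · rw [MahlerIntegrable, TorusIntegrable, Pi.zero_def]
    change IntegrableOn (fun θ : Fin 2 → ℝ => log ‖MvPolynomial.eval (torusMap 0 1 θ) P‖)
      (Icc (0 : Fin 2 → ℝ) (fun _ => 2 * π))
    rw [hcomp, hpre, hmp.integrableOn_comp_preimage e.measurableEmbedding, IntegrableOn, hIcc]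
    exact hprod
  · rw [mahlerMeasureLog]
    have : ∫ θ in Icc (0 : Fin 2 → ℝ) (fun _ => 2 * π),
        log ‖MvPolynomial.eval (torusMap 0 1 θ) P‖ =
        2 * π * ∫ θ in Ioc 0 (2 * π), logMeanCos (A θ) (B θ) := by
      rw [show (∫ θ in Icc (0 : Fin 2 → ℝ) (fun _ => 2 * π),
        log ‖MvPolynomial.eval (torusMap 0 1 θ) P‖) =
          ∫ θ in Icc (0 : Fin 2 → ℝ) (fun _ => 2 * π), (f ∘ e) θ by rw [← hcomp], hpre]
      simp only [Function.comp_apply]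
      rw [hmp.setIntegral_preimage_emb e.measurableEmbedding, hIcc, integral_prod _ hprod]
      simp only [hslice]
      rw [integral_const_mul]
    rw [this]
    have := pi_pos.ne'
    norm_num [zpow_neg]
    field_simp

lemma torusMap_zero_one_apply (θ : Fin 2 → ℝ) (i : Fin 2) :
    torusMap 0 1 θ i = Complex.exp (θ i * Complex.I) := by
  simp [torusMap]

lemma norm_eval_polyQ (α : ℝ) (θ : Fin 2 → ℝ) :
    ‖MvPolynomial.eval (torusMap 0 1 θ) (polyQ α)‖ =
      |2 * (2 + 2 * cos (θ 0) - 1) * cos (θ 1 - θ 0 / 2) + α * (2 * cos (θ 0 / 2))| := by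
  have key : MvPolynomial.eval (torusMap 0 1 θ) (polyQ α) =
      Complex.exp ((3 * (θ 0 / 2) + θ 1 : ℝ) * Complex.I) *
      ((2 * (2 + 2 * cos (θ 0) - 1) * cos (θ 1 - θ 0 / 2) + α * (2 * cos (θ 0 / 2)) : ℝ) : ℂ) := by
    -- The symmetric form of Q_α arises on division by x^{3/2} y; the half angle t makes √x = e^{it}
    -- available.
    obtain ⟨t, ht⟩ : ∃ t, θ 0 = 2 * t := ⟨θ 0 / 2, by ring⟩
    simp only [polyQ, map_add, map_mul, map_pow, MvPolynomial.eval_X, MvPolynomial.eval_C,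
      map_one, torusMap_zero_one_apply, ht]
    rw [mul_div_cancel_left₀ _ (two_ne_zero' ℝ)]
    push_cast
    simp only [Complex.cos, mul_sub, sub_mul, add_mul, neg_mul, neg_sub, Complex.exp_add,
      Complex.exp_sub, Complex.exp_neg]
    rw [show (2 : ℂ) * t * Complex.I = (2 : ℕ) * (t * Complex.I) by push_cast; ring,
      show (3 : ℂ) * t * Complex.I = (3 : ℕ) * (t * Complex.I) by push_cast; ring,
      Complex.exp_nat_mul, Complex.exp_nat_mul]
    have hx := Complex.exp_ne_zero (t * Complex.I)
    have hy := Complex.exp_ne_zero (θ 1 * Complex.I)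
    generalize Complex.exp (t * Complex.I) = x at hx ⊢
    generalize Complex.exp (θ 1 * Complex.I) = y at hy ⊢
    field_simp
    ring
  rw [key, norm_mul, Complex.norm_exp_ofReal_mul_I, one_mul, Complex.norm_real, norm_eq_abs]

lemma norm_eval_polyR (α : ℝ) (θ : Fin 2 → ℝ) :
    ‖MvPolynomial.eval (torusMap 0 1 θ) (polyR (α + 2))‖ =
      |2 * (2 + 2 * cos (θ 0) - 1) * cos (θ 1 - θ 0) +
        ((2 + 2 * cos (θ 0)) ^ 2 + (α - 2) * (2 + 2 * cos (θ 0)) - 2)| := by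
  have key : MvPolynomial.eval (torusMap 0 1 θ) (polyR (α + 2)) =
      Complex.exp ((2 * θ 0 + θ 1 : ℝ) * Complex.I) *
      ((2 * (2 + 2 * cos (θ 0) - 1) * cos (θ 1 - θ 0) +
        ((2 + 2 * cos (θ 0)) ^ 2 + (α - 2) * (2 + 2 * cos (θ 0)) - 2) : ℝ) : ℂ) := by
    simp only [polyR, map_add, map_mul, map_sub, map_pow, MvPolynomial.eval_X, MvPolynomial.eval_C,
      map_one, torusMap_zero_one_apply, map_ofNat]
    push_cast
    simp only [Complex.cos, mul_sub, sub_mul, add_mul, neg_mul, neg_sub, Complex.exp_add,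
      Complex.exp_sub, Complex.exp_neg]
    rw [show (2 : ℂ) * θ 0 * Complex.I = (2 : ℕ) * (θ 0 * Complex.I) by push_cast; ring,
      Complex.exp_nat_mul]
    have hx := Complex.exp_ne_zero (θ 0 * Complex.I)
    have hy := Complex.exp_ne_zero (θ 1 * Complex.I)
    generalize Complex.exp (θ 0 * Complex.I) = x at hx ⊢
    generalize Complex.exp (θ 1 * Complex.I) = y at hy ⊢
    field_simp
    ring
  rw [key, norm_mul, Complex.norm_exp_ofReal_mul_I, one_mul, Complex.norm_real, norm_eq_abs]

/-- Here 2 cos(θ/2) = ±√z, and the sign is harmless because `logMeanCos` depends on B only through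
|B|. The half angle keeps the shift and B continuous in θ. -/
lemma logMeanCos_half_angle (α θ : ℝ) :
    logMeanCos (2 + 2 * cos θ - 1) (α * (2 * cos (θ / 2))) = meanQ α (2 + 2 * cos θ) := by
  have h : 2 + 2 * cos θ = (2 * cos (θ / 2)) ^ 2 := by
    have := cos_two_mul (θ / 2)
    rw [mul_div_cancel₀ _ (two_ne_zero' ℝ)] at this
    rw [this]
    ring
  rw [meanQ, logMeanCos, logMeanCos, abs_mul, abs_mul α √_, h, Real.sqrt_sq_eq_abs, abs_abs]

lemma two_mul_abs_one_add_two_mul_cos_le (θ : ℝ) : 2 * |2 + 2 * cos θ - 1| ≤ 6 := by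
  have : |2 + 2 * cos θ - 1| ≤ 3 :=
    abs_le.2 ⟨by linarith [neg_one_le_cos θ], by linarith [cos_le_one θ]⟩
  linarith

theorem mahler_polyQ {α : ℝ} (hα : 4 ≤ α) : MahlerIntegrable (polyQ α) ∧
    mahlerMeasureLog (polyQ α) =
      (2 * π)⁻¹ * ∫ θ in Ioc 0 (2 * π), meanQ α (2 + 2 * cos θ) := by
  have := mahler_of_norm_eval_eq (P := polyQ α) (A := fun θ => 2 + 2 * cos θ - 1)
    (B := fun θ => α * (2 * cos (θ / 2))) (s := fun θ => θ / 2) (M := 6 + |α| * 2)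
    (by fun_prop) (by fun_prop) (by fun_prop) (fun θ => ?_) (norm_eval_polyQ α) ?_
  · simpa only [logMeanCos_half_angle] using this
  · rw [abs_mul, abs_mul 2, abs_two]
    gcongr
    · exact two_mul_abs_one_add_two_mul_cos_le θ
    · linarith [abs_cos_le_one (θ / 2)]
  · simpa only [logMeanCos_half_angle] using integrableOn_meanQ hα

theorem mahler_polyR {α : ℝ} (hα : 4 ≤ α) : MahlerIntegrable (polyR (α + 2)) ∧
    mahlerMeasureLog (polyR (α + 2)) =
      (2 * π)⁻¹ * ∫ θ in Ioc 0 (2 * π), meanR α (2 + 2 * cos θ) := by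
  refine mahler_of_norm_eval_eq (P := polyR (α + 2)) (A := fun θ => 2 + 2 * cos θ - 1)
    (B := fun θ => (2 + 2 * cos θ) ^ 2 + (α - 2) * (2 + 2 * cos θ) - 2) (s := fun θ => θ)
    (M := 6 + (4 * α + 6))
    (by fun_prop) (by fun_prop) (by fun_prop) (fun θ => ?_) (norm_eval_polyR α)
    (integrableOn_meanR hα)
  have h0 : 0 ≤ 2 + 2 * cos θ := by linarith [neg_one_le_cos θ]
  have h4 := two_add_two_mul_cos_le θ
  refine add_le_add (two_mul_abs_one_add_two_mul_cos_le θ) (abs_le.2 ⟨?_, by nlinarith⟩)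
  linarith [meanR_arg_ge hα h0]

end

theorem theorem1p2 (α : ℝ) (hα : 4 ≤ α) :
    MahlerIntegrable (polyQ α) ∧ MahlerIntegrable (polyR (α + 2)) ∧
      mahlerMeasureLog (polyQ α) = mahlerMeasureLog (polyR (α + 2)) := by
  obtain ⟨hQ, hQ'⟩ := mahler_polyQ hα
  obtain ⟨hR, hR'⟩ := mahler_polyR hα
  exact ⟨hQ, hR, by rw [hQ', hR', integral_meanQ_eq_integral_meanR hα]⟩
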